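/- Let $n\ge 2$. Let $G_n=\langle x_1,\dots,x_n \mid x_i^{-1}x_j^2x_ix_j^2 \ (i\ne j)\rangle$ be the combinatorial Hantzsche–Wendt group and let $W_n=\langle x_1,\dots,x_n\mid x_1^2,\dots,x_n^2\rangle$, the free product of $n$ copies of $\mathbb Z/2$. Let $\nu:G_n\to W_n$ be the homomorphism with $\nu(x_i)=x_i$, and let $\iota:\mathbb Z^n\to G_n$ be the homomorphism sending the standard basis vector $e_i$ to $x_i^2$ (the elements $x_i^2$ commute pairwise). Then $$1\to\mathbb Z^n\xrightarrow{\ \iota\ }G_n\xrightarrow{\ \nu\ }W_n\to 1$$ is a short exact sequence, and, regarding $\mathbb Z^n$ as a subgroup of $G_n$ via $\iota$, there is a unique homomorphism $h:W_n\to GL(n,\mathbb Z)$ such that $$h(w)(e_i)=\bar w\,e_i\,\bar w^{-1}\qquad\text{for all } w\in W_n,\ \bar w\in G_n \text{ with } \nu(\bar w)=w,\ \text{ and } 1\le i\le n.$$ Its kernel $K=\ker h$ contains the commutator subgroup $[W_n,W_n]$ and is nontrivial, and $K$ is a free group of finite rank $$1+(n-2)\,2^{\,2\lfloor n/2\rfloor-1}.$$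 -/

import Mathlib

noncomputable section

namespace HantzscheWendt

/-- The relators `xᵢ⁻¹ xⱼ² xᵢ xⱼ²` for `i ≠ j`. -/
def relG (n : ℕ) : Set (FreeGroup (Fin n)) :=
  {r | ∃ i j : Fin n, i ≠ j ∧
    r = (FreeGroup.of i)⁻¹ * FreeGroup.of j ^ 2 * FreeGroup.of i * FreeGroup.of j ^ 2}

/-- The combinatorial Hantzsche-Wendt group `Gₙ`. -/
abbrev G (n : ℕ) : Type := PresentedGroup (relG n)

/-- The generator `xᵢ` of `Gₙ`. -/
def x {n : ℕ} (i : Fin n) : G n := PresentedGroup.of i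

/-- The relators `xᵢ²`. -/
def relW (n : ℕ) : Set (FreeGroup (Fin n)) :=
  {r | ∃ i : Fin n, r = FreeGroup.of i ^ 2}

/-- The group `Wₙ = ⟨x₁, …, xₙ ∣ x₁², …, xₙ²⟩`, the free product of `n` copies of `ℤ/2`. -/
abbrev W (n : ℕ) : Type := PresentedGroup (relW n)

theorem x_rel {n : ℕ} {i j : Fin n} (hij : i ≠ j) :
    (x i)⁻¹ * x j ^ 2 * x i * x j ^ 2 = 1 :=
  PresentedGroup.one_of_mem (rels := relG n) ⟨i, j, hij, rfl⟩

theorem w_sq {n : ℕ} (i : Fin n) : (PresentedGroup.of i : W n) ^ 2 = 1 :=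
  PresentedGroup.one_of_mem (rels := relW n) ⟨i, rfl⟩

/-- The canonical map `ν : Gₙ → Wₙ`, sending generators to generators. -/
def nu (n : ℕ) : G n →* W n :=
  PresentedGroup.toGroup (f := fun i => (PresentedGroup.of i : W n)) (by
    rintro r ⟨i, j, _, rfl⟩
    simp [w_sq])

theorem commute_sq {n : ℕ} {i j : Fin n} (hij : i ≠ j) : Commute (x i ^ 2) (x j ^ 2) := by
  have h1 : (x i)⁻¹ * x j ^ 2 * x i = (x j ^ 2)⁻¹ := eq_inv_of_mul_eq_one_left (x_rel hij)
  have h2 : (x i)⁻¹ * (x j ^ 2)⁻¹ * x i = x j ^ 2 := by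
    have h := congrArg (fun g => g⁻¹) h1
    simpa [mul_assoc] using h
  have h3 : (x i)⁻¹ * ((x i)⁻¹ * x j ^ 2 * x i) * x i = x j ^ 2 := by rw [h1, h2]
  show x i ^ 2 * x j ^ 2 = x j ^ 2 * x i ^ 2
  calc x i ^ 2 * x j ^ 2 = x i ^ 2 * ((x i)⁻¹ * ((x i)⁻¹ * x j ^ 2 * x i) * x i) := by rw [h3]
    _ = x j ^ 2 * x i ^ 2 := by simp [mul_assoc, pow_two]

theorem commute_zpowers {n : ℕ} : Pairwise fun i j : Fin n =>
    ∀ a b : Multiplicative ℤ,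
      Commute (zpowersHom (G n) (x i ^ 2) a) (zpowersHom (G n) (x j ^ 2) b) := by
  intro i j hij a b
  rw [zpowersHom_apply, zpowersHom_apply]
  exact (commute_sq hij).zpow_zpow _ _

/-- The map `ι : ℤⁿ → Gₙ`, `(a₁, …, aₙ) ↦ x₁^(2a₁) ⋯ xₙ^(2aₙ)`, whose image is the subgroup
generated by the `xᵢ²`. The additive group `ℤⁿ` is written multiplicatively. -/
def iota (n : ℕ) : Multiplicative (Fin n → ℤ) →* G n :=
  (MonoidHom.noncommPiCoprod (N := fun _ : Fin n => Multiplicative ℤ)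
    (fun i => zpowersHom (G n) (x i ^ 2)) commute_zpowers).comp
  (MulEquiv.piMultiplicative (fun _ : Fin n => ℤ)).toMonoidHom

/-- The standard basis vector `eᵢ` of `ℤⁿ`. -/
def e {n : ℕ} (i : Fin n) : Fin n → ℤ := Pi.single i 1

theorem iota_e {n : ℕ} (i : Fin n) : iota n (Multiplicative.ofAdd (e i)) = x i ^ 2 := by
  have h : MulEquiv.piMultiplicative (fun _ : Fin n => ℤ) (Multiplicative.ofAdd (e i))
      = Pi.mulSingle i (Multiplicative.ofAdd 1) := by
    ext j
    by_cases hj : j = i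
    · subst hj; simp [e]
    · simp [e, hj]
  simp only [iota, MonoidHom.comp_apply, MulEquiv.toMonoidHom_eq_coe, MonoidHom.coe_coe, h]
  rw [MonoidHom.noncommPiCoprod_mulSingle]
  simp

/-- `h : Wₙ → GL(n, ℤ)` is the conjugation representation of the extension
`1 → ℤⁿ → Gₙ → Wₙ → 1`: whenever `ν(g) = w`, one has `h(w)(eᵢ) = g eᵢ g⁻¹` for all `i`,
where `ℤⁿ` is regarded as a subgroup of `Gₙ` through `ι`. -/
def IsConjRep {n : ℕ} (h : W n →* Matrix.GeneralLinearGroup (Fin n) ℤ) : Prop :=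
  ∀ (w : W n) (g : G n), nu n g = w → ∀ i : Fin n,
    iota n (Multiplicative.ofAdd (Matrix.mulVec (h w : Matrix (Fin n) (Fin n) ℤ) (e i)))
      = g * iota n (Multiplicative.ofAdd (e i)) * g⁻¹

end HantzscheWendt

end

noncomputable section

namespace HantzscheWendt

/-! Conjugation by `x i` fixes `e i` and negates every other `e j`. Hence the image of `iota` is
normal and the conjugation action is `signHom` followed by diagonal matrices, so `K = ker signHom`,
which contains the commutators since the target is abelian. Modulo the image of `iota` the relations
of `W n` hold, which gives exactness in the middle. Injectivity of `iota` is seen in an affine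
action on `ℤⁿ`, where `x i ^ 2` translates by `2 e i`.

Let `Q` be the finite image of `signHom`. Each generator maps to a nontrivial involution, so the
Cayley graph of `Q`, with one unoriented edge per involution, is `n`-regular without fixed edges,
and `K` is its fundamental group. It is free of rank `1 - |Q| + n|Q|/2 = 1 + (n-2)|Q|/2`, and a
parity argument gives `|Q| = 2 ^ (2⌊n/2⌋)`. -/

theorem x_closure (n : ℕ) : Subgroup.closure (Set.range (x : Fin n → G n)) = ⊤ :=
  PresentedGroup.closure_range_of _

theorem w_closure (n : ℕ) :
    Subgroup.closure (Set.range (PresentedGroup.of : Fin n → W n)) = ⊤ :=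
  PresentedGroup.closure_range_of _

@[simp] theorem nu_x {n : ℕ} (i : Fin n) : nu n (x i) = PresentedGroup.of i :=
  PresentedGroup.toGroup.of _

theorem nu_surjective (n : ℕ) : Function.Surjective (nu n) := by
  rw [← MonoidHom.range_eq_top, eq_top_iff, ← w_closure, Subgroup.closure_le]
  rintro _ ⟨i, rfl⟩
  exact ⟨x i, nu_x i⟩

/-- Homomorphisms out of `ℤⁿ` are determined by their values on the standard basis. -/
theorem hom_ext_e {n : ℕ} {H : Type*} [Group H] {f g : Multiplicative (Fin n → ℤ) →* H}
    (hfg : ∀ i, f (Multiplicative.ofAdd (e i)) = g (Multiplicative.ofAdd (e i))) : f = g := by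
  have key : ∀ s : Finset (Fin n), ∀ v : Fin n → ℤ,
      Multiplicative.ofAdd (∑ i ∈ s, v i • (e i : Fin n → ℤ)) ∈ f.eqLocus g := by
    intro s v
    rw [ofAdd_sum]
    refine Subgroup.prod_mem _ fun i _ => ?_
    rw [ofAdd_zsmul]
    exact Subgroup.zpow_mem _ (hfg i) _
  refine MonoidHom.ext fun v => ?_
  have h := key Finset.univ v.toAdd
  have hv : ∑ i, v.toAdd i • (e i : Fin n → ℤ) = v.toAdd := by
    ext j
    simp [e, Finset.sum_apply, Pi.single_apply]
  rw [hv] at h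
  exact h

/-! ### Sign action and exactness -/

/-- The signs by which conjugation by `xᵢ` acts on the basis vectors. -/
def sign {n : ℕ} (i : Fin n) : Fin n → ℤˣ := fun j => if j = i then 1 else -1

theorem sign_mul_self {n : ℕ} (i : Fin n) : sign i * sign i = 1 :=
  funext fun j => by simp [Int.units_mul_self]

/-- The homomorphism `Wₙ → {±1}ⁿ` recording the signs of the diagonal matrices `h(w)`. -/
def signHom (n : ℕ) : W n →* (Fin n → ℤˣ) :=
  PresentedGroup.toGroup (f := sign) (by
    rintro r ⟨i, rfl⟩
    simp [pow_two, sign_mul_self])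

@[simp] theorem signHom_of {n : ℕ} (i : Fin n) : signHom n (PresentedGroup.of i) = sign i :=
  PresentedGroup.toGroup.of _

/-- The coordinatewise action of `{±1}ⁿ` on `ℤⁿ`. -/
def flip {n : ℕ} (s : Fin n → ℤˣ) : Multiplicative (Fin n → ℤ) →* Multiplicative (Fin n → ℤ) :=
  AddMonoidHom.toMultiplicative
    { toFun := fun v j => (s j : ℤ) * v j
      map_zero' := by ext; simp
      map_add' := fun v w => by ext; simp [mul_add] }

theorem flip_mul {n : ℕ} (s t : Fin n → ℤˣ) (v : Multiplicative (Fin n → ℤ)) :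
    flip (s * t) v = flip s (flip t v) := by
  apply Multiplicative.toAdd.injective
  ext j
  simp [flip, mul_assoc]

theorem flip_one {n : ℕ} (v : Multiplicative (Fin n → ℤ)) : flip 1 v = v := by
  apply Multiplicative.toAdd.injective
  ext j
  simp [flip]

theorem flip_sign_e {n : ℕ} (i j : Fin n) : flip (sign i) (Multiplicative.ofAdd (e j)) =
    if j = i then Multiplicative.ofAdd (e j) else (Multiplicative.ofAdd (e j))⁻¹ := by
  apply Multiplicative.toAdd.injective
  ext k
  by_cases hk : k = j
  · subst hk
    by_cases h : k = i <;> simp [flip, sign, e, h]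
  · by_cases h : j = i <;> simp [flip, e, h] <;> grind

theorem conj_sq {n : ℕ} {i j : Fin n} (hij : i ≠ j) :
    x i * x j ^ 2 * (x i)⁻¹ = (x j ^ 2)⁻¹ := by
  have h : (x i)⁻¹ * x j ^ 2 * x i = (x j ^ 2)⁻¹ := eq_inv_of_mul_eq_one_left (x_rel hij)
  rw [← inv_inj, inv_inv]
  calc (x i * x j ^ 2 * (x i)⁻¹)⁻¹ = x i * (x j ^ 2)⁻¹ * (x i)⁻¹ := by group
    _ = x j ^ 2 := by rw [← h]; group

theorem iota_flip {n : ℕ} (g : G n) (v : Multiplicative (Fin n → ℤ)) :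
    iota n (flip (signHom n (nu n g)) v) = g * iota n v * g⁻¹ := by
  have hg : g ∈ Subgroup.closure (Set.range (x : Fin n → G n)) := by simp [x_closure]
  induction hg using Subgroup.closure_induction generalizing v with
  | mem g hg =>
    obtain ⟨i, rfl⟩ := hg
    have h : (iota n).comp (flip (sign i)) =
        (MulAut.conj (x i)).toMonoidHom.comp (iota n) := by
      refine hom_ext_e fun j => ?_
      by_cases hj : j = i
      · subst hj
        simp [flip_sign_e, iota_e, pow_two, mul_assoc]
      · simpa [flip_sign_e, iota_e, hj] using (conj_sq (Ne.symm hj)).symm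
    simpa using DFunLike.congr_fun h v
  | one => simp [flip_one]
  | mul a b _ _ ha hb =>
    rw [map_mul, map_mul, flip_mul, ha, hb]
    group
  | inv a _ ha =>
    have h := ha (flip (signHom n (nu n a⁻¹)) v)
    rw [← flip_mul, ← map_mul, ← map_mul, mul_inv_cancel, map_one, map_one, flip_one] at h
    rw [h]
    group

/-- Translations of `ℤⁿ` by twice a vector. -/
def doubleTranslation (n : ℕ) : Multiplicative (Fin n → ℤ) →* Equiv.Perm (Fin n → ℤ) where
  toFun v := Equiv.addLeft (v.toAdd + v.toAdd)
  map_one' := by ext; simp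
  map_mul' v w := by ext; simp; ring

/-- The glide reflection `v ↦ sign(i) v + eᵢ` of `ℤⁿ`. -/
def glide {n : ℕ} (i : Fin n) : Equiv.Perm (Fin n → ℤ) where
  toFun v := fun j => (sign i j : ℤ) * v j + e i j
  invFun v := fun j => (sign i j : ℤ) * (v j - e i j)
  left_inv v := by
    ext j
    by_cases h : j = i <;> simp [sign, h]
  right_inv v := by
    ext j
    by_cases h : j = i <;> simp [sign, h]

theorem glide_sq {n : ℕ} (i : Fin n) :
    glide i ^ 2 = doubleTranslation n (Multiplicative.ofAdd (e i)) := by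
  ext v j
  by_cases h : j = i
  · simp [glide, doubleTranslation, pow_two, sign, h]; ring
  · simp [glide, doubleTranslation, pow_two, sign, e, h]

/-- The affine action of `Gₙ` on `ℤⁿ` by glide reflections. -/
def affineAction (n : ℕ) : G n →* Equiv.Perm (Fin n → ℤ) :=
  PresentedGroup.toGroup (f := glide) (by
    rintro r ⟨i, j, hij, rfl⟩
    simp only [map_mul, map_inv, map_pow, FreeGroup.lift_apply_of, mul_assoc, inv_mul_eq_one]
    -- With `t` the translation by `2 e j`, the relation reads `t * glide i * t = glide i`; it holds
    -- because `glide i` negates coordinate `j`.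
    rw [glide_sq]
    ext v k
    by_cases h : k = i
    · subst h
      simp [glide, doubleTranslation, sign, e, hij]
    · simp [glide, doubleTranslation, sign, h]
      ring)

@[simp] theorem affineAction_x {n : ℕ} (i : Fin n) : affineAction n (x i) = glide i :=
  PresentedGroup.toGroup.of _

theorem iota_injective (n : ℕ) : Function.Injective (iota n) := by
  have h : (affineAction n).comp (iota n) = doubleTranslation n :=
    hom_ext_e fun i => by simp [iota_e, glide_sq]
  refine Function.Injective.of_comp (f := affineAction n) ?_
  rw [← MonoidHom.coe_comp, h]
  intro v w hvw
  apply Multiplicative.toAdd.injective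
  ext j
  have := congrFun (DFunLike.congr_fun hvw 0) j
  simp [doubleTranslation] at this
  omega

theorem range_iota (n : ℕ) : (iota n).range = (nu n).ker := by
  apply le_antisymm
  · have h : (nu n).comp (iota n) = 1 := hom_ext_e fun i => by simp [iota_e, w_sq]
    rintro _ ⟨v, rfl⟩
    exact DFunLike.congr_fun h v
  · have : (iota n).range.Normal := ⟨by
      rintro _ ⟨v, rfl⟩ g
      exact ⟨_, iota_flip g v⟩⟩
    -- The quotient map factors through `nu` via `f`, so `ker nu` dies in the quotient.
    let f : W n →* G n ⧸ (iota n).range :=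
      PresentedGroup.toGroup (f := fun i => QuotientGroup.mk' (iota n).range (x i)) (by
        rintro r ⟨i, rfl⟩
        simp only [map_pow, FreeGroup.lift_apply_of]
        rw [← map_pow, ← MonoidHom.mem_ker, QuotientGroup.ker_mk']
        exact ⟨_, iota_e i⟩)
    have hf : f.comp (nu n) = QuotientGroup.mk' (iota n).range := by
      refine PresentedGroup.ext fun i => ?_
      change f (nu n (x i)) = _
      rw [nu_x]
      exact PresentedGroup.toGroup.of _
    intro g hg
    rw [← QuotientGroup.ker_mk' (iota n).range, ← hf]
    simp [MonoidHom.mem_ker, MonoidHom.mem_ker.1 hg]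

/-! ### The conjugation representation -/

/-- The homomorphism sending a vector of signs to the corresponding diagonal matrix. -/
def diagHom (n : ℕ) : (Fin n → ℤˣ) →* Matrix.GeneralLinearGroup (Fin n) ℤ :=
  (Units.map (Matrix.diagonalRingHom (Fin n) ℤ : (Fin n → ℤ) →* _)).comp
    (MulEquiv.piUnits (M := fun _ : Fin n => ℤ)).symm.toMonoidHom

theorem coe_diagHom {n : ℕ} (s : Fin n → ℤˣ) :
    (diagHom n s : Matrix (Fin n) (Fin n) ℤ) = Matrix.diagonal fun j => (s j : ℤ) := rfl

theorem diagHom_injective (n : ℕ) : Function.Injective (diagHom n) := by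
  intro s t h
  have h' := congrArg (fun g : Matrix.GeneralLinearGroup (Fin n) ℤ => g.1) h
  simp only [coe_diagHom] at h'
  have := Matrix.diagonal_injective h'
  ext j
  exact congrFun this j

/-- The conjugation representation `Wₙ → GL(n, ℤ)`. -/
def conjRep (n : ℕ) : W n →* Matrix.GeneralLinearGroup (Fin n) ℤ :=
  (diagHom n).comp (signHom n)

theorem isConjRep_conjRep (n : ℕ) : IsConjRep (conjRep n) := by
  rintro _ g rfl i
  rw [← iota_flip]
  refine congrArg (iota n) (Multiplicative.toAdd.injective (funext fun j => ?_))
  simp [conjRep, coe_diagHom, Matrix.mulVec_diagonal, flip]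

theorem IsConjRep.eq {n : ℕ} {h h' : W n →* Matrix.GeneralLinearGroup (Fin n) ℤ}
    (hh : IsConjRep h) (hh' : IsConjRep h') : h' = h := by
  refine MonoidHom.ext fun w => ?_
  ext i j
  obtain ⟨g, hg⟩ := nu_surjective n w
  have h1 := (hh' w g hg j).trans (hh w g hg j).symm
  have h2 := congrFun (Multiplicative.ofAdd.injective (iota_injective n h1)) i
  simpa [e, Matrix.mulVec_single] using h2

theorem ker_conjRep (n : ℕ) : (conjRep n).ker = (signHom n).ker := by
  ext w
  simp only [MonoidHom.mem_ker, conjRep, MonoidHom.comp_apply]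
  rw [← map_one (diagHom n), (diagHom_injective n).eq_iff]

theorem commutator_le_ker_signHom (n : ℕ) : commutator (W n) ≤ (signHom n).ker :=
  Abelianization.commutator_subset_ker _

/-! ### Kernels as fundamental groups of Cayley graphs -/

section Kernel

variable {n : ℕ} {Q : Type} [Group Q] {d : Fin n → Q}

/-- A spanning tree, rooted at `1`, of the Cayley graph of `Q` with respect to the involutions
`d i`: `dir q` is the label of the edge from `q` to its parent, and `len` decreases along these
edges. -/
structure SpanningTree (d : Fin n → Q) where
  /-- The label of the edge towards the root. -/
  dir : Q → Fin n
  /-- The distance to the root. -/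
  len : Q → ℕ
  len_lt : ∀ q, q ≠ 1 → len (d (dir q) * q) < len q
  mul_self : ∀ i, d i * d i = 1

/-- Take `len` to be word length and `dir q` the first letter of a shortest word for `q`. -/
theorem exists_spanningTree (hn : 0 < n) (hd : ∀ i, d i * d i = 1)
    (hgen : ∀ q : Q, ∃ l : List (Fin n), (l.map d).prod = q) : Nonempty (SpanningTree d) := by
  classical
  have hex : ∀ q : Q, ∃ k, ∃ l : List (Fin n), l.length = k ∧ (l.map d).prod = q := fun q =>
    let ⟨l, hl⟩ := hgen q
    ⟨_, l, rfl, hl⟩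
  have key : ∀ q : Q, ∃ i : Fin n, q ≠ 1 → Nat.find (hex (d i * q)) < Nat.find (hex q) := by
    intro q
    obtain ⟨l, hl, hq⟩ := Nat.find_spec (hex q)
    cases l with
    -- The root has no parent, so its label is arbitrary.
    | nil => exact ⟨⟨0, hn⟩, fun h => absurd hq.symm h⟩
    | cons i l =>
      refine ⟨i, fun _ => ?_⟩
      rw [← hl, List.length_cons, Nat.lt_succ_iff]
      refine Nat.find_min' _ ⟨l, rfl, ?_⟩
      rw [← hq, List.map_cons, List.prod_cons, ← mul_assoc, hd, one_mul]
  choose f hf using key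
  exact ⟨⟨f, fun q => Nat.find (hex q), hf, hd⟩⟩

namespace SpanningTree

variable (T : SpanningTree d)

include T in
theorem cancel (i : Fin n) (q : Q) : d i * (d i * q) = q := by
  rw [← mul_assoc, T.mul_self, one_mul]

/-- The edge `(i, q)`, joining `q` to `d i * q`, goes from `q` towards the root. -/
def IsUp (a : Fin n × Q) : Prop := a.2 ≠ 1 ∧ a.1 = T.dir a.2

/-- Reversal of edges. -/
def rev (_ : SpanningTree d) (a : Fin n × Q) : Fin n × Q := (a.1, d a.1 * a.2)

theorem rev_rev (a : Fin n × Q) : T.rev (T.rev a) = a := by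
  simp [rev, T.cancel]

/-- The edges outside of the tree. -/
def NonTree (a : Fin n × Q) : Prop := ¬ T.IsUp a ∧ ¬ T.IsUp (T.rev a)

open Classical in
/-- The word in `Wₙ` which leads from the root to `q` along the tree. -/
def path (q : Q) : W n :=
  if h : q = 1 then 1 else PresentedGroup.of (T.dir q) * path (d (T.dir q) * q)
termination_by T.len q
decreasing_by exact T.len_lt q h

theorem path_one : T.path 1 = 1 := by
  rw [path]; simp

theorem path_of_ne_one {q : Q} (h : q ≠ 1) :
    T.path q = PresentedGroup.of (T.dir q) * T.path (d (T.dir q) * q) := by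
  rw [path, dif_neg h]

theorem path_induction {p : Q → Prop} (one : p 1)
    (step : ∀ q, q ≠ 1 → p (d (T.dir q) * q) → p q) (q : Q) : p q := by
  induction hk : T.len q using Nat.strong_induction_on generalizing q with
  | _ k ih =>
    by_cases h : q = 1
    · exact h ▸ one
    · exact step q h (ih _ (hk ▸ T.len_lt q h) _ rfl)

theorem map_path {φ : W n →* Q} (hφ : ∀ i, φ (PresentedGroup.of i) = d i) (q : Q) :
    φ (T.path q) = q := by
  induction q using T.path_induction with
  | one => simp [path_one]
  | step q h ih => rw [T.path_of_ne_one h, map_mul, ih, hφ, T.cancel]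

/-- The loop at the root through the edge `a`. -/
def loop (a : Fin n × Q) : W n :=
  (T.path (d a.1 * a.2))⁻¹ * PresentedGroup.of a.1 * T.path a.2

theorem loop_rev (a : Fin n × Q) : T.loop (T.rev a) = (T.loop a)⁻¹ := by
  have h : (PresentedGroup.of a.1 : W n)⁻¹ = PresentedGroup.of a.1 := by
    rw [inv_eq_iff_mul_eq_one, ← pow_two, w_sq]
  simp [loop, rev, T.cancel, h, mul_assoc]

theorem loop_of_isUp {a : Fin n × Q} (ha : T.IsUp a) : T.loop a = 1 := by
  obtain ⟨h, h'⟩ := ha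
  have h2 : (PresentedGroup.of a.1 : W n) * PresentedGroup.of a.1 = 1 := by rw [← pow_two, w_sq]
  rw [loop, T.path_of_ne_one h, ← h', mul_assoc, ← mul_assoc (PresentedGroup.of a.1), h2, one_mul,
    inv_mul_cancel]

theorem loop_eq_one {a : Fin n × Q} (ha : ¬ T.NonTree a) : T.loop a = 1 := by
  by_cases h : T.IsUp a
  · exact T.loop_of_isUp h
  · have h' : T.IsUp (T.rev a) := by_contra fun h' => ha ⟨h, h'⟩
    rw [← T.rev_rev a, loop_rev, T.loop_of_isUp h', inv_one]

variable [LinearOrder Q]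

/-- The positively oriented edges outside of the tree. -/
abbrev Gen : Type := {a : Fin n × Q // T.NonTree a ∧ a.2 < d a.1 * a.2}

open Classical in
/-- The generator attached to an edge, or `1` if there is none. -/
def gen (a : Fin n × Q) : FreeGroup T.Gen :=
  if h : T.NonTree a ∧ a.2 < d a.1 * a.2 then FreeGroup.of ⟨a, h⟩ else 1

/-- The element of the free group attached to an edge. -/
def label (a : Fin n × Q) : FreeGroup T.Gen := T.gen a * (T.gen (T.rev a))⁻¹

theorem label_rev (a : Fin n × Q) : T.label (T.rev a) = (T.label a)⁻¹ := by
  simp [label, T.rev_rev]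

theorem label_of_isUp {a : Fin n × Q} (ha : T.IsUp a) : T.label a = 1 := by
  rw [label, gen, dif_neg fun h => h.1.1 ha, gen,
    dif_neg fun h => h.1.2 (by rwa [T.rev_rev]), inv_one, mul_one]

theorem label_gen (a : T.Gen) : T.label a = FreeGroup.of a := by
  rw [label, gen, dif_pos a.2, gen, dif_neg, inv_one, mul_one]
  intro h
  have h2 := h.2
  rw [rev, T.cancel] at h2
  exact lt_asymm a.2.2 h2

/-- The action of a generator on `Q × F`. -/
def genPerm (i : Fin n) : Equiv.Perm (Q × FreeGroup T.Gen) :=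
  Function.Involutive.toPerm (fun p => (d i * p.1, T.label (i, p.1) * p.2)) fun p => by
    have h := T.label_rev (i, p.1)
    simp only [rev] at h
    simp [T.cancel, h]

/-- The action of `Wₙ` on the covering `Q × F` of `Q`. -/
def action : W n →* Equiv.Perm (Q × FreeGroup T.Gen) :=
  PresentedGroup.toGroup (f := T.genPerm) (by
    rintro r ⟨i, rfl⟩
    ext1 p
    rw [map_pow, FreeGroup.lift_apply_of, pow_two]
    exact (T.genPerm i).left_inv p)

theorem action_of (i : Fin n) (p : Q × FreeGroup T.Gen) :
    T.action (PresentedGroup.of i) p = (d i * p.1, T.label (i, p.1) * p.2) := by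
  rw [action, PresentedGroup.toGroup.of]
  rfl

/-- Tree edges carry trivial labels, so the free coordinate never changes along a tree path. -/
theorem action_path (q : Q) (f : FreeGroup T.Gen) : T.action (T.path q) (1, f) = (q, f) := by
  induction q using T.path_induction with
  | one => simp [path_one]
  | step q h ih =>
    have h1 := T.label_rev (T.dir q, q)
    rw [T.label_of_isUp (a := (T.dir q, q)) ⟨h, rfl⟩, inv_one, rev] at h1
    rw [T.path_of_ne_one h, map_mul, Equiv.Perm.mul_apply, ih, action_of, T.cancel, h1, one_mul]

theorem action_loop (a : Fin n × Q) (f : FreeGroup T.Gen) :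
    T.action (T.loop a) (1, f) = (1, T.label a * f) := by
  rw [loop, map_mul, map_mul, Equiv.Perm.mul_apply, Equiv.Perm.mul_apply, action_path, action_of,
    map_inv, Equiv.Perm.inv_eq_iff_eq, action_path]

/-- The homomorphism sending a generator to the corresponding loop. -/
def loopHom : FreeGroup T.Gen →* W n := FreeGroup.lift fun a => T.loop a

theorem loopHom_gen (a : Fin n × Q) (h : T.NonTree a → a.2 < d a.1 * a.2) :
    T.loopHom (T.gen a) = T.loop a := by
  by_cases ha : T.NonTree a
  · rw [gen, dif_pos ⟨ha, h ha⟩, loopHom, FreeGroup.lift_apply_of]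
  · rw [gen, dif_neg fun h => ha h.1, map_one, T.loop_eq_one ha]

/-- If `d i = 1`, an edge would be its own reverse and get a trivial label, though its loop need not
be trivial; `hne` excludes this. -/
theorem loopHom_label (hne : ∀ i, d i ≠ 1) (a : Fin n × Q) :
    T.loopHom (T.label a) = T.loop a := by
  wlog h : a.2 < d a.1 * a.2 generalizing a
  · have h1 := this (T.rev a) (by
      rw [rev, T.cancel]
      exact lt_of_le_of_ne (not_lt.1 h) (by simp [hne]))
    rwa [label_rev, loop_rev, map_inv, inv_inj] at h1
  · rw [label, map_mul, T.loopHom_gen a fun _ => h, gen, dif_neg, inv_one, map_one, mul_one]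
    intro h'
    have h2 := h'.2
    rw [rev, T.cancel] at h2
    exact lt_asymm h h2

theorem action_loopHom (g f : FreeGroup T.Gen) :
    T.action (T.loopHom g) (1, f) = (1, g * f) := by
  induction g generalizing f with
  | C1 => simp
  | of a => rw [loopHom, FreeGroup.lift_apply_of, action_loop, label_gen]
  | inv_of a ih => rw [map_inv, map_inv, Equiv.Perm.inv_eq_iff_eq, ih, mul_inv_cancel_left]
  | mul a b ha hb => rw [map_mul, map_mul, Equiv.Perm.mul_apply, hb, ha, mul_assoc]

/-- Loops act on the fibre over `1` by left multiplication, which is faithful. -/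
theorem loopHom_injective : Function.Injective T.loopHom := by
  intro g g' h
  have h1 := T.action_loopHom g 1
  rw [h, action_loopHom] at h1
  simpa using (congrArg Prod.snd h1).symm

/-- Reidemeister–Schreier rewriting: the walk spelled by `w` from `q`, closed up along the tree, is
a product of edge loops. -/
theorem exists_loopHom_eq (hne : ∀ i, d i ≠ 1) {φ : W n →* Q}
    (hφ : ∀ i, φ (PresentedGroup.of i) = d i) (w : W n) (q : Q) :
    ∃ g, T.loopHom g = (T.path (φ w * q))⁻¹ * w * T.path q := by
  have hw : w ∈ Subgroup.closure (Set.range (PresentedGroup.of : Fin n → W n)) := by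
    simp
  induction hw using Subgroup.closure_induction generalizing q with
  | mem w hw =>
    obtain ⟨i, rfl⟩ := hw
    exact ⟨T.label (i, q), by rw [T.loopHom_label hne, hφ, loop]⟩
  | one => exact ⟨1, by simp⟩
  | mul a b _ _ ha hb =>
    obtain ⟨g, hg⟩ := hb q
    obtain ⟨g', hg'⟩ := ha (φ b * q)
    exact ⟨g' * g, by rw [map_mul, map_mul, hg, hg', mul_assoc (φ a)]; group⟩
  | inv a _ ha =>
    obtain ⟨g, hg⟩ := ha (φ a⁻¹ * q)
    refine ⟨g⁻¹, ?_⟩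
    rw [map_inv T.loopHom, hg, ← mul_assoc, ← map_mul, mul_inv_cancel, map_one, one_mul]
    group

theorem range_loopHom (hne : ∀ i, d i ≠ 1) {φ : W n →* Q}
    (hφ : ∀ i, φ (PresentedGroup.of i) = d i) : T.loopHom.range = φ.ker := by
  apply le_antisymm
  · rw [loopHom, FreeGroup.range_lift_eq_closure, Subgroup.closure_le]
    rintro _ ⟨a, rfl⟩
    simp [loop, T.map_path hφ, hφ]
  · intro w hw
    obtain ⟨g, hg⟩ := T.exists_loopHom_eq hne hφ w 1
    refine ⟨g, ?_⟩
    rw [hg, MonoidHom.mem_ker.1 hw, one_mul, path_one]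
    simp

/-- The kernel of a homomorphism `Wₙ → Q` is free on the edges outside of a spanning tree. -/
def kerEquiv (hne : ∀ i, d i ≠ 1) {φ : W n →* Q}
    (hφ : ∀ i, φ (PresentedGroup.of i) = d i) : φ.ker ≃* FreeGroup T.Gen :=
  ((MonoidHom.ofInjective T.loopHom_injective).trans
    (MulEquiv.subgroupCongr (T.range_loopHom hne hφ))).symm

/-- The edges outside of a spanning tree, counted in both directions. -/
theorem two_mul_card_gen [Finite Q] (hne : ∀ i, d i ≠ 1) :
    2 * Nat.card T.Gen + 2 * (Nat.card Q - 1) = n * Nat.card Q := by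
  classical
  have := Fintype.ofFinite Q
  -- `P`, `U` and their reversals partition the `n * |Q|` directed edges; `U` has one edge for each
  -- vertex other than the root.
  let P : Finset (Fin n × Q) := {a | T.NonTree a ∧ a.2 < d a.1 * a.2}
  let U : Finset (Fin n × Q) := {a | T.IsUp a}
  have hinj : Function.Injective T.rev := Function.Involutive.injective T.rev_rev
  have hP : Nat.card T.Gen = P.card := by
    rw [Nat.card_eq_fintype_card, Fintype.card_subtype]
  have hU : U.card = Nat.card Q - 1 := by
    rw [Nat.card_eq_fintype_card, ← Finset.card_univ, ← Finset.card_erase_of_mem (Finset.mem_univ 1)]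
    symm
    refine Finset.card_bij (fun q _ => (T.dir q, q)) ?_ ?_ ?_
    · intro q hq
      exact Finset.mem_filter.2 ⟨Finset.mem_univ _, Finset.ne_of_mem_erase hq, rfl⟩
    · intro q _ q' _ h
      exact congrArg Prod.snd h
    · rintro ⟨i, q⟩ h
      obtain ⟨h1, h2⟩ : T.IsUp (i, q) := (Finset.mem_filter.1 h).2
      exact ⟨q, Finset.mem_erase.2 ⟨h1, Finset.mem_univ _⟩, Prod.ext h2.symm rfl⟩
  have hasymm : ∀ a, T.IsUp a → ¬ T.IsUp (T.rev a) := by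
    rintro ⟨i, q⟩ ⟨h1, h2⟩ ⟨h3, h4⟩
    simp only [rev] at h1 h2 h3 h4
    have h5 := T.len_lt q h1
    have h6 := T.len_lt _ h3
    rw [← h4, T.cancel] at h6
    rw [← h2] at h5
    exact lt_asymm h5 h6
  have hrev : ∀ a, T.NonTree (T.rev a) ↔ T.NonTree a := fun a => by
    rw [NonTree, NonTree, T.rev_rev, and_comm]
  have mem_image : ∀ (S : Finset (Fin n × Q)) a, a ∈ S.image T.rev ↔ T.rev a ∈ S := by
    intro S a
    rw [Finset.mem_image]
    exact ⟨by rintro ⟨b, hb, rfl⟩; rwa [T.rev_rev], fun h => ⟨_, h, T.rev_rev a⟩⟩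
  have hcard : (P ∪ P.image T.rev).card = 2 * P.card := by
    rw [Finset.card_union_of_disjoint, Finset.card_image_of_injective _ hinj, two_mul]
    rw [Finset.disjoint_left]
    intro a ha hb
    rw [mem_image] at hb
    simp only [P, Finset.mem_filter, Finset.mem_univ, true_and] at ha hb
    have := hb.2
    rw [rev, T.cancel] at this
    exact lt_asymm ha.2 this
  have hcard' : (U ∪ U.image T.rev).card = 2 * U.card := by
    rw [Finset.card_union_of_disjoint, Finset.card_image_of_injective _ hinj, two_mul]
    rw [Finset.disjoint_left]
    intro a ha hb
    rw [mem_image] at hb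
    simp only [U, Finset.mem_filter, Finset.mem_univ, true_and] at ha hb
    exact hasymm a ha hb
  have hcompl : (U ∪ U.image T.rev)ᶜ = P ∪ P.image T.rev := by
    ext a
    have htri : a.2 < d a.1 * a.2 ∨ d a.1 * a.2 < a.2 :=
      lt_or_gt_of_ne (by simp [hne])
    have h1 : (T.rev a).2 < d (T.rev a).1 * (T.rev a).2 ↔ d a.1 * a.2 < a.2 := by
      rw [rev, T.cancel]
    rw [Finset.mem_compl, Finset.mem_union, Finset.mem_union, mem_image, mem_image]
    simp only [U, P, Finset.mem_filter, Finset.mem_univ, true_and, hrev, h1, not_or]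
    change T.NonTree a ↔ _
    tauto
  have h := Finset.card_add_card_compl (U ∪ U.image T.rev)
  rw [hcompl, hcard, hcard', hU, ← hP] at h
  rw [add_comm, h]
  simp

end SpanningTree
end Kernel

/-! ### Order of the sign group and the rank -/

section Rank

variable {n : ℕ}

/-- The product of the entries of a vector of signs. -/
def signProd (n : ℕ) : (Fin n → ℤˣ) →* ℤˣ where
  toFun s := ∏ j, s j
  map_one' := by simp
  map_mul' s t := by simp [Finset.prod_mul_distrib]

theorem signProd_sign (i : Fin n) : signProd n (sign i) = (-1) ^ (n - 1) := by
  simp [signProd, sign, Finset.prod_ite, Finset.filter_ne', Finset.card_erase_of_mem]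

theorem ker_signProd_le_range (hn : 0 < n) : (signProd n).ker ≤ (signHom n).range := by
  intro s hs
  have hs' : ∏ j, s j = 1 := hs
  let o : Fin n := ⟨0, hn⟩
  -- As the entries multiply to `1`, the corrections at `o` cancel; flipping exactly `j` and `o` is
  -- `sign j * sign o`.
  have h : ∏ j, (Pi.mulSingle j (s j) * Pi.mulSingle o (s j) : Fin n → ℤˣ) = s := by
    rw [Finset.prod_mul_distrib, Finset.univ_prod_mulSingle]
    have h1 : ∏ j, (Pi.mulSingle o (s j) : Fin n → ℤˣ) = Pi.mulSingle o (∏ j, s j) :=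
      (map_prod (MonoidHom.mulSingle (fun _ : Fin n => ℤˣ) o) _ _).symm
    rw [h1, hs', Pi.mulSingle_one, mul_one]
  rw [← h]
  refine Subgroup.prod_mem _ fun j _ => ?_
  rcases Int.units_eq_one_or (s j) with hj | hj
  · rw [hj, Pi.mulSingle_one, Pi.mulSingle_one, mul_one]
    exact Subgroup.one_mem _
  · refine ⟨PresentedGroup.of j * PresentedGroup.of o, ?_⟩
    rw [map_mul, signHom_of, signHom_of, hj]
    ext k
    simp only [sign, Pi.mul_apply, Pi.mulSingle_apply]
    split_ifs <;> rfl

/-- Each `sign i` has product `(-1) ^ (n - 1)`: for even `n` the image is everything, for odd `n` it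
is the index-two kernel of `signProd`. -/
theorem card_range_signHom (hn : 0 < n) : Nat.card (signHom n).range = 2 ^ (2 * (n / 2)) := by
  let o : Fin n := ⟨0, hn⟩
  have htotal : Nat.card (Fin n → ℤˣ) = 2 ^ n := by simp
  rcases Nat.even_or_odd n with he | ho
  · have htop : (signHom n).range = ⊤ := by
      refine eq_top_iff.2 fun s _ => ?_
      have ho : sign o ∈ (signHom n).range := ⟨_, signHom_of o⟩
      rcases Int.units_eq_one_or (signProd n s) with h | h
      · exact ker_signProd_le_range hn h
      · rw [← Subgroup.mul_mem_cancel_right _ ho]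
        refine ker_signProd_le_range hn ?_
        rw [MonoidHom.mem_ker, map_mul, h, signProd_sign,
          Odd.neg_one_pow (Nat.Even.sub_odd hn he odd_one)]
        rfl
    rw [htop, Subgroup.card_top, htotal, Nat.two_mul_div_two_of_even he]
  · have hker : (signHom n).range = (signProd n).ker := by
      refine le_antisymm ?_ (ker_signProd_le_range hn)
      rw [MonoidHom.range_eq_map, ← w_closure, MonoidHom.map_closure, Subgroup.closure_le]
      rintro _ ⟨_, ⟨i, rfl⟩, rfl⟩
      rw [signHom_of, SetLike.mem_coe, MonoidHom.mem_ker, signProd_sign]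
      exact Even.neg_one_pow (Nat.Odd.sub_odd ho odd_one)
    have hsurj : (signProd n).range = ⊤ := by
      refine MonoidHom.range_eq_top.2 fun u => ⟨Pi.mulSingle o u, ?_⟩
      simp [signProd]
    have h := (signProd n).ker.card_mul_index
    rw [Subgroup.index_ker, hsurj, Subgroup.card_top, htotal, ← hker] at h
    have h2 : Nat.card ℤˣ = 2 := by simp
    have h3 : 2 * (n / 2) + 1 = n := Nat.two_mul_div_two_add_one_of_odd ho
    rw [h2] at h
    have h4 : 2 ^ n = 2 ^ (2 * (n / 2)) * 2 := by rw [← pow_succ, h3]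
    exact Nat.eq_of_mul_eq_mul_right two_pos (h.trans h4)

theorem sign_ne_one (hn : 2 ≤ n) (i : Fin n) : sign i ≠ 1 := by
  have : Nontrivial (Fin n) := Fin.nontrivial_iff_two_le.2 hn
  obtain ⟨j, hj⟩ := exists_ne i
  intro h
  have := congrFun h j
  simp [sign, hj] at this

theorem rank_eq {n N g : ℕ} (hn : 2 ≤ n) (hN : N = 2 ^ (2 * (n / 2)))
    (h : 2 * g + 2 * (N - 1) = n * N) : g = 1 + (n - 2) * 2 ^ (2 * (n / 2) - 1) := by
  -- Since `n ≥ 2` the exponent is positive, so its truncated predecessor is exact and `N` is even.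
  obtain ⟨k, hk⟩ : ∃ k, 2 * (n / 2) = k + 1 := ⟨2 * (n / 2) - 1, by omega⟩
  obtain ⟨m, rfl⟩ := Nat.exists_eq_add_of_le hn
  rw [hk] at hN ⊢
  rw [pow_succ] at hN
  have hpos : 0 < 2 ^ k := by positivity
  simp only [Nat.add_sub_cancel, Nat.add_sub_cancel_left]
  generalize 2 ^ k = M at *
  subst hN
  have h1 : (2 + m) * (M * 2) = 2 * (2 * M) + 2 * (m * M) := by ring
  rw [h1] at h
  omega

theorem nonempty_ker_signHom_equiv (hn : 2 ≤ n) : Nonempty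
    ((signHom n).ker ≃* FreeGroup (Fin (1 + (n - 2) * 2 ^ (2 * (n / 2) - 1)))) := by
  have hn0 : 0 < n := by omega
  let φ := (signHom n).rangeRestrict
  let d : Fin n → (signHom n).range := fun i => φ (PresentedGroup.of i)
  have hd : ∀ i, d i * d i = 1 := fun i => by
    rw [← map_mul, ← pow_two, w_sq, map_one]
  have hne : ∀ i, d i ≠ 1 := fun i h => by
    refine sign_ne_one hn i ?_
    rw [← signHom_of]
    exact congrArg Subtype.val h
  have hgen : ∀ q, ∃ l : List (Fin n), (l.map d).prod = q := by
    intro q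
    obtain ⟨w, rfl⟩ := (signHom n).rangeRestrict_surjective q
    have hw : w ∈ Subgroup.closure (Set.range (PresentedGroup.of : Fin n → W n)) := by simp
    induction hw using Subgroup.closure_induction with
    | mem w hw =>
      obtain ⟨i, rfl⟩ := hw
      exact ⟨[i], by simp [d, φ]⟩
    | one => exact ⟨[], by simp⟩
    | mul a b _ _ ha hb =>
      obtain ⟨l, hl⟩ := ha
      obtain ⟨l', hl'⟩ := hb
      exact ⟨l ++ l', by rw [List.map_append, List.prod_append, hl, hl', map_mul]⟩
    | inv a _ ha =>
      obtain ⟨l, hl⟩ := ha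
      -- Every sign vector is its own inverse, so the same word serves.
      refine ⟨l, ?_⟩
      rw [hl, map_inv, eq_inv_iff_mul_eq_one]
      ext j
      simp [Int.units_mul_self]
  obtain ⟨T⟩ := exists_spanningTree hn0 hd hgen
  -- Any order will do; it only picks an orientation of each edge.
  let : LinearOrder (signHom n).range := LinearOrder.lift' _ (Finite.equivFin _).injective
  have hcard := rank_eq hn (card_range_signHom hn0) (T.two_mul_card_gen hne)
  rw [← (signHom n).ker_rangeRestrict, ← hcard]
  exact ⟨(T.kerEquiv hne (φ := φ) fun _ => rfl).trans
    (FreeGroup.freeGroupCongr (Finite.equivFin T.Gen))⟩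

end Rank

end HantzscheWendt

end

theorem mainTheorem9 (n : ℕ) (hn : 2 ≤ n) :
    (Function.Injective (HantzscheWendt.iota n) ∧
      (HantzscheWendt.iota n).range = (HantzscheWendt.nu n).ker ∧
      Function.Surjective (HantzscheWendt.nu n)) ∧
    ∃ h : HantzscheWendt.W n →* Matrix.GeneralLinearGroup (Fin n) ℤ,
      HantzscheWendt.IsConjRep h ∧
      (∀ h' : HantzscheWendt.W n →* Matrix.GeneralLinearGroup (Fin n) ℤ,
        HantzscheWendt.IsConjRep h' → h' = h) ∧
      commutator (HantzscheWendt.W n) ≤ h.ker ∧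
      h.ker ≠ ⊥ ∧
      Nonempty (h.ker ≃* FreeGroup (Fin (1 + (n - 2) * 2 ^ (2 * (n / 2) - 1)))) := by
  refine ⟨⟨HantzscheWendt.iota_injective n, HantzscheWendt.range_iota n,
    HantzscheWendt.nu_surjective n⟩, HantzscheWendt.conjRep n,
    HantzscheWendt.isConjRep_conjRep n,
    fun h' hh' => (HantzscheWendt.isConjRep_conjRep n).eq hh', ?_⟩
  rw [HantzscheWendt.ker_conjRep]
  have hfree := HantzscheWendt.nonempty_ker_signHom_equiv hn
  refine ⟨HantzscheWendt.commutator_le_ker_signHom n, ?_, hfree⟩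
  obtain ⟨f⟩ := hfree
  -- The rank is at least `1`, so the free group is nontrivial.
  have : Nonempty (Fin (1 + (n - 2) * 2 ^ (2 * (n / 2) - 1))) := ⟨⟨0, by omega⟩⟩
  have := f.toEquiv.nontrivial
  exact (Subgroup.nontrivial_iff_ne_bot _).1 this
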